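/- Let $k \ge 2$ and $n \ge 0$ be integers. A $k$-graph on $[n]=\{1,\dots,n\}$ is a set $E$ of $k$-element subsets of $[n]$ (hyperedges); its underlying graph joins two distinct vertices whenever some hyperedge of $E$ contains both. A graph with more than two vertices is $2$-connected if it is connected and remains connected after the deletion of any single vertex, and a $k$-graph is $2$-connected if its underlying graph is. Let $\Delta_{n,k}^2$ be the simplicial complex whose vertices are hyperedges and whose simplices are the $k$-graphs on $[n]$ that are not $2$-connected. For an integer $r$, a space $X$ is topologically $r$-connected if it is nonempty in case $r \ge -1$ and, for all $0 \le j \le r$, every continuous map $S^j \to X$ extends to a continuous map $B^{j+1} \to X$ (so there is no condition for $r \le -2$). If $n \ne k$, then (the geometric realization of) $\Delta_{n,k}^2$ is topologically $\left(\left\lceil \frac{n}{k-1} \right\rceil - 3\right)$-connected. Moreover, for all $n$, the reduced simplicial homology with integer coefficients satisfies $\widetilde{H}_i(\Delta_{n,k}^2) = 0$ for $i = 0, 1, \dots, \left\lceil \frac{n}{k-1} \right\rceil - 3$. -/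

import Mathlib

/-! ### Uniform hypergraphs and `i`-connectedness -/

/-- A graph is `i`-connected, for a number `i` with `0 < i < |V|`, if the deletion of any `j < i`
vertices, with all edges at them, leaves a graph in which any two vertices are joined by a path. -/
def GraphIsConnected {V : Type*} [Fintype V] (i : ℕ) (G : SimpleGraph V) : Prop :=
  0 < i ∧ i < Fintype.card V ∧
    ∀ S : Finset V, S.card < i → (G.induce {v | v ∉ S}).Preconnected

/-- The possible hyperedges of a `k`-graph on the vertex set `Fin n`: the `k`-element subsets.
A `k`-graph is a finite set of hyperedges. -/
abbrev Hyperedge (n k : ℕ) : Type := {X : Finset (Fin n) // X.card = k}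

/-- The underlying graph of a `k`-graph: every hyperedge is replaced by a clique. -/
def underlyingGraph {n k : ℕ} (E : Finset (Hyperedge n k)) : SimpleGraph (Fin n) where
  Adj u v := u ≠ v ∧ ∃ X ∈ E, u ∈ X.1 ∧ v ∈ X.1
  symm := ⟨fun _ _ h => ⟨h.1.symm, h.2.imp fun _ hX => ⟨hX.1, hX.2.2, hX.2.1⟩⟩⟩
  loopless := ⟨fun _ h => h.1 rfl⟩

/-- A `k`-graph is `i`-connected if its underlying graph is. -/
def HypergraphIsConnected {n k : ℕ} (i : ℕ) (E : Finset (Hyperedge n k)) : Prop :=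
  GraphIsConnected i (underlyingGraph E)

theorem HypergraphIsConnected.mono {n k i : ℕ} {E F : Finset (Hyperedge n k)} (h : E ⊆ F)
    (hE : HypergraphIsConnected i E) : HypergraphIsConnected i F := by
  refine ⟨hE.1, hE.2.1, fun S hS => (hE.2.2 S hS).mono ?_⟩
  intro u v huv
  obtain ⟨hne, X, hX, hu, hv⟩ := huv
  exact ⟨hne, X, h hX, hu, hv⟩

/-- The simplicial complex `Δ^i_{n,k}` of all not `i`-connected `k`-graphs on `n` vertices. Its
simplices are the `k`-graphs, regarded as sets of hyperedges (the empty simplex is not listed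
among the faces of a `PreAbstractSimplicialComplex`). -/
def notConnectedComplex (i n k : ℕ) : PreAbstractSimplicialComplex (Hyperedge n k) where
  faces := {E | E.Nonempty ∧ ¬ HypergraphIsConnected i E}
  isRelLowerSet_faces := fun _ hF =>
    ⟨hF.1, fun _ hEF hE => ⟨hE, fun hcon => hF.2 (hcon.mono hEF)⟩⟩

/-! ### Geometric realization and topological connectedness -/

/-- The geometric realization of a finite simplicial complex, in barycentric coordinates, with
the subspace topology from `ι → ℝ`. -/
def realization {ι : Type*} [Fintype ι] (K : PreAbstractSimplicialComplex ι) : Set (ι → ℝ) :=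
  {x | (∀ v, 0 ≤ x v) ∧ ∑ v, x v = 1 ∧ ∃ s ∈ K, ∀ v, v ∉ s → x v = 0}

/-- A space is topologically `r`-connected, for an integer `r`, if for all `0 ≤ j ≤ r` every
continuous map from the sphere `S^j` extends to the ball `B^{j+1}`, and if it is moreover
nonempty in case `r ≥ -1`. There is no condition for `r ≤ -2`. -/
def TopologicallyConnected (r : ℤ) (X : Type*) [TopologicalSpace X] : Prop :=
  (-1 ≤ r → Nonempty X) ∧
    ∀ j : ℕ, (j : ℤ) ≤ r →
      ∀ f : C(Metric.sphere (0 : EuclideanSpace ℝ (Fin (j + 1))) 1, X),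
        ∃ g : C(Metric.closedBall (0 : EuclideanSpace ℝ (Fin (j + 1))) 1, X),
          ∀ x : Metric.sphere (0 : EuclideanSpace ℝ (Fin (j + 1))) 1,
            g ⟨x.1, Metric.sphere_subset_closedBall x.2⟩ = f x

/-! ### Reduced simplicial homology with integer coefficients -/

/-- The tuple `t` lists the vertices of a simplex of `K` without repetition. The empty tuple lists
the empty simplex, which belongs to every complex. -/
def IsSimplexTuple {ι : Type*} [DecidableEq ι] (K : PreAbstractSimplicialComplex ι) {q : ℕ}
    (t : Fin q → ι) : Prop :=
  Function.Injective t ∧ (q = 0 ∨ Finset.univ.image t ∈ K)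

/-- The oriented simplicial chains of a finite complex spanned by the simplices with `q` vertices
(of dimension `q - 1`): integer valued functions `c` of the oriented simplices
`[t 0, …, t (q - 1)]` of `K`, where a permutation of the vertices multiplies the value by its
sign; `c` is extended by zero to the tuples that do not list a simplex. For `q = 0` this is the
group `ℤ` that is added in dimension `-1`. -/
def orientedChains {ι : Type*} [DecidableEq ι] (K : PreAbstractSimplicialComplex ι) (q : ℕ) :
    Submodule ℤ ((Fin q → ι) → ℤ) where
  carrier := {c | (∀ t, ¬ IsSimplexTuple K t → c t = 0) ∧
    ∀ (σ : Equiv.Perm (Fin q)) (t : Fin q → ι), c (t ∘ σ) = (Equiv.Perm.sign σ : ℤ) * c t}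
  add_mem' := fun {a b} ha hb =>
    ⟨fun t ht => by simp [ha.1 t ht, hb.1 t ht], fun σ t => by
      simp only [Pi.add_apply, ha.2, hb.2, mul_add]⟩
  zero_mem' := ⟨fun _ _ => rfl, fun _ _ => by simp⟩
  smul_mem' := fun m a ha =>
    ⟨fun t ht => by simp [ha.1 t ht], fun σ t => by
      simp only [Pi.smul_apply, ha.2, smul_eq_mul]; ring⟩

theorem IsSimplexTuple.of_cons {ι : Type*} [DecidableEq ι] {K : PreAbstractSimplicialComplex ι}
    {q : ℕ} {v : ι} {t : Fin q → ι} (h : IsSimplexTuple K (Fin.cons v t : Fin (q + 1) → ι)) :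
    IsSimplexTuple K t := by
  obtain ⟨hinj, hK⟩ := h
  refine ⟨(Fin.cons_injective_iff.1 hinj).2, ?_⟩
  rcases Nat.eq_zero_or_pos q with hq | hq
  · exact Or.inl hq
  · right
    have hK' := hK.resolve_left (Nat.succ_ne_zero q)
    refine (K.isRelLowerSet_faces hK').2 ?_ ⟨t ⟨0, hq⟩, Finset.mem_image_of_mem t (Finset.mem_univ _)⟩
    intro x hx
    obtain ⟨j, -, rfl⟩ := Finset.mem_image.1 hx
    exact Finset.mem_image.2 ⟨j.succ, Finset.mem_univ _, by simp⟩

theorem cons_comp_perm {ι : Type*} {q : ℕ} (v : ι) (t : Fin q → ι) (σ : Equiv.Perm (Fin q)) :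
    (Fin.cons v (t ∘ σ) : Fin (q + 1) → ι) =
      (Fin.cons v t : Fin (q + 1) → ι) ∘ Equiv.Perm.decomposeFin.symm (0, σ) := by
  funext j
  refine Fin.cases ?_ (fun j => ?_) j <;> simp

/-- The boundary operator, from chains of dimension `q` to chains of dimension `q - 1`. On the
elementary chain of an oriented simplex `[v₀, …, v_q]` it is the alternating sum over `j` of
`(-1) ^ j` times the oriented simplex without `v_j`: the coefficient of `∂ c` at an oriented
simplex `[t]` is the sum of the coefficients of `c` at the oriented simplices `[v, t]`. For
`q = 0` it is the augmentation. -/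
def boundaryMap {ι : Type*} [Fintype ι] [DecidableEq ι] (K : PreAbstractSimplicialComplex ι)
    (q : ℕ) : orientedChains K (q + 1) →ₗ[ℤ] orientedChains K q where
  toFun c := ⟨fun t => ∑ v, c.1 (Fin.cons v t),
    fun t ht => Finset.sum_eq_zero fun v _ => c.2.1 _ fun h => ht h.of_cons,
    fun σ t => by
      rw [Finset.mul_sum]
      refine Finset.sum_congr rfl fun v _ => ?_
      rw [cons_comp_perm, c.2.2, Equiv.Perm.decomposeFin.symm_sign]
      simp⟩
  map_add' a b := by
    ext t
    simp [Finset.sum_add_distrib]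
  map_smul' m a := by
    ext t
    simp [Finset.mul_sum]

theorem boundaryMap_boundaryMap {ι : Type*} [Fintype ι] [DecidableEq ι]
    (K : PreAbstractSimplicialComplex ι) (q : ℕ) (c : orientedChains K (q + 2)) :
    boundaryMap K q (boundaryMap K (q + 1) c) = 0 := by
  ext t
  change ∑ v, ∑ w, c.1 (Fin.cons w (Fin.cons v t)) = 0
  have hswap : ∀ v w, c.1 (Fin.cons w (Fin.cons v t)) = - c.1 (Fin.cons v (Fin.cons w t)) := by
    intro v w
    have h := c.2.2 (Equiv.swap 0 1) (Fin.cons v (Fin.cons w t))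
    rw [Equiv.Perm.sign_swap (by simp)] at h
    have e : (Fin.cons v (Fin.cons w t : Fin (q + 1) → ι) : Fin (q + 2) → ι) ∘ Equiv.swap 0 1 =
        Fin.cons w (Fin.cons v t : Fin (q + 1) → ι) := by
      funext j
      refine Fin.cases ?_ (fun j => Fin.cases ?_ (fun j => ?_) j) j
      · simp
      · change (Fin.cons v (Fin.cons w t : Fin (q + 1) → ι) : Fin (q + 2) → ι)
          (Equiv.swap 0 1 1) = _
        rw [Equiv.swap_apply_right]
        rfl
      · change (Fin.cons v (Fin.cons w t : Fin (q + 1) → ι) : Fin (q + 2) → ι)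
          (Equiv.swap 0 1 j.succ.succ) = _
        have hj : Equiv.swap (0 : Fin (q + 2)) 1 j.succ.succ = j.succ.succ :=
          Equiv.swap_apply_of_ne_of_ne (Fin.succ_ne_zero _)
            (fun h => Fin.succ_ne_zero j (Fin.succ_injective _ h))
        rw [hj]
        rfl
    rw [e] at h
    simpa using h
  have h2 : ∑ v, ∑ w, c.1 (Fin.cons w (Fin.cons v t)) =
      - ∑ v, ∑ w, c.1 (Fin.cons w (Fin.cons v t)) := by
    conv_lhs => rw [Finset.sum_comm]
    rw [← Finset.sum_neg_distrib]
    refine Finset.sum_congr rfl fun v _ => ?_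
    rw [← Finset.sum_neg_distrib]
    exact Finset.sum_congr rfl fun w _ => hswap w v
  omega

/-- The reduced simplicial homology group of `K` in dimension `i ≥ 0`, with integer coefficients:
cycles modulo boundaries. -/
abbrev ReducedHomology {ι : Type*} [Fintype ι] [DecidableEq ι]
    (K : PreAbstractSimplicialComplex ι) (i : ℕ) : Type _ :=
  LinearMap.ker (boundaryMap K i) ⧸
    (LinearMap.range (boundaryMap K (i + 1))).submoduleOf (LinearMap.ker (boundaryMap K i))

/-! A 2-connected k-graph E on n ≠ k vertices has at least n/(k-1) hyperedges
(`HypergraphIsConnected.le_card_mul`). Some vertex v lies in two hyperedges, and after its deletion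
the remainders of the hyperedges still connect the other n-1 vertices. Attached one at a time to a
growing set, each remainder brings in at most its size minus one new vertices. The total of these
numbers is |E|(k-1) minus the degree of v, and this degree is at least 2, which gives n ≤ |E|(k-1).

Hence, with D = ⌈n/(k-1)⌉ - 1, every nonempty set of at most D hyperedges is a simplex: the complex
contains the full (D-1)-skeleton. Cycles of dimension at most D-2 then bound, since the cone over
such a cycle with any apex stays in the complex. Spheres of dimension at most D-2 bound balls, since
a filling in the full simplex can be pushed into the (D-1)-skeleton by general position
(`HasFullSkeleton.exists_extension`). -/

/-! ### Counting the hyperedges of a 2-connected k-graph -/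

/-- In a `2`-connected `k`-graph some vertex lies in two hyperedges, unless there is a hyperedge
consisting of all the vertices. -/
theorem HypergraphIsConnected.exists_mem_two {n k : ℕ} {E : Finset (Hyperedge n k)} (hnk : n ≠ k)
    (h : HypergraphIsConnected 2 E) :
    ∃ v, ∃ X ∈ E, ∃ Y ∈ E, X ≠ Y ∧ v ∈ X.1 ∧ v ∈ Y.1 := by
  obtain ⟨-, hn, hc⟩ := h
  rw [Fintype.card_fin] at hn
  have hcross : ∀ A : Set (Fin n), A.Nonempty → Aᶜ.Nonempty →
      ∃ u ∈ A, ∃ w ∉ A, ∃ X ∈ E, u ∈ X.1 ∧ w ∈ X.1 := by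
    rintro A ⟨a, ha⟩ ⟨b, hb⟩
    obtain ⟨p⟩ := hc ∅ (by simp) ⟨a, by simp⟩ ⟨b, by simp⟩
    obtain ⟨d, -, h1, h2⟩ := p.exists_boundary_dart {x | x.1 ∈ A} ha hb
    obtain ⟨-, X, hX, hu, hv⟩ := d.adj
    exact ⟨_, h1, _, h2, X, hX, hu, hv⟩
  obtain ⟨u, -, w, -, X, hX, hu, -⟩ := hcross {⟨0, by omega⟩} ⟨_, rfl⟩
    ⟨⟨1, by omega⟩, by simp [Fin.ext_iff]⟩
  have hXc : (X.1 : Set (Fin n))ᶜ.Nonempty := by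
    rw [Set.nonempty_compl]
    intro hun
    have := X.2
    rw [Finset.coe_eq_univ.1 hun, Finset.card_univ, Fintype.card_fin] at this
    exact hnk this
  -- A hyperedge that leaves `X` meets it in the required vertex.
  obtain ⟨v, hv, w, hw, Y, hY, hvY, hwY⟩ := hcross X.1 ⟨u, hu⟩ hXc
  exact ⟨v, X, hX, Y, hY, fun h => hw (by rw [h]; exact hwY), hv, hvY⟩

/-- If the deletion of `v` leaves a `k`-graph connected, then the remainders of the hyperedges are
numerous enough to join the remaining vertices. -/
theorem card_le_sum_of_preconnected_induce {n k : ℕ} {E : Finset (Hyperedge n k)} (hn : 2 ≤ n)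
    (v : Fin n)
    (h : ((underlyingGraph E).induce {u | u ∉ ({v} : Finset (Fin n))}).Preconnected) :
    n ≤ 2 + ∑ X ∈ E, ((X.1.erase v).card - 1) := by
  classical
  obtain ⟨x, hx⟩ : ∃ x : Fin n, x ≠ v := by
    have : Nontrivial (Fin n) := Fin.nontrivial_iff_two_le.2 hn
    exact exists_ne v
  -- `A` grows from `x` by remainders that meet it. As it avoids `v`, it is complete at n - 1
  -- vertices, that is, at m = n - 2.
  suffices hgrow : ∀ m, m + 2 ≤ n → ∃ F ⊆ E, ∃ A : Finset (Fin n), v ∉ A ∧ x ∈ A ∧ m + 1 ≤ A.card ∧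
      (∀ X ∈ F, X.1.erase v ⊆ A) ∧ A.card ≤ 1 + ∑ X ∈ F, ((X.1.erase v).card - 1) by
    obtain ⟨F, hF, A, -, -, h1, -, h2⟩ := hgrow (n - 2) (by omega)
    have := Finset.sum_le_sum_of_subset (f := fun X : Hyperedge n k => (X.1.erase v).card - 1) hF
    omega
  intro m
  induction m with
  | zero =>
    exact fun _ => ⟨∅, by simp, {x}, by simpa using hx.symm, by simp, by simp, by simp, by simp⟩
  | succ m ih =>
    intro hm
    obtain ⟨F, hF, A, hvA, hxA, h1, hFA, h2⟩ := ih (by omega)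
    by_cases hA : m + 2 ≤ A.card
    · exact ⟨F, hF, A, hvA, hxA, hA, hFA, h2⟩
    obtain ⟨y, hy⟩ : ∃ y, y ∉ insert v A := by
      by_contra! hall
      have h3 := Finset.card_insert_le v A
      rw [Finset.eq_univ_iff_forall.2 hall, Finset.card_univ, Fintype.card_fin] at h3
      omega
    rw [Finset.mem_insert, not_or] at hy
    obtain ⟨p⟩ := h ⟨x, by simpa using hx⟩ ⟨y, by simpa using hy.1⟩
    obtain ⟨d, -, hd1, hd2⟩ := p.exists_boundary_dart {z | z.1 ∈ A} hxA hy.2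
    obtain ⟨-, X, hX, hu, hw⟩ := d.adj
    have hdu : d.fst.1 ∈ X.1.erase v := Finset.mem_erase.2 ⟨by simpa using d.fst.2, hu⟩
    have hdw : d.snd.1 ∈ X.1.erase v := Finset.mem_erase.2 ⟨by simpa using d.snd.2, hw⟩
    have hXF : X ∉ F := fun hXF => hd2 (hFA X hXF hdw)
    refine ⟨insert X F, Finset.insert_subset hX hF, A ∪ X.1.erase v, ?_, ?_, ?_, ?_, ?_⟩
    · simp [hvA]
    · simp [hxA]
    · have : A ⊂ A ∪ X.1.erase v :=
        ⟨Finset.subset_union_left, fun hs => hd2 (hs (Finset.mem_union_right _ hdw))⟩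
      have := Finset.card_lt_card this
      omega
    · intro Z hZ
      rcases Finset.mem_insert.1 hZ with rfl | hZ
      · exact Finset.subset_union_right
      · exact (hFA Z hZ).trans Finset.subset_union_left
    · rw [Finset.sum_insert hXF]
      have h3 := Finset.card_union_add_card_inter A (X.1.erase v)
      have h4 : 0 < (A ∩ X.1.erase v).card :=
        Finset.card_pos.2 ⟨_, Finset.mem_inter.2 ⟨hd1, hdu⟩⟩
      omega

/-- A `2`-connected `k`-graph on `n ≠ k` vertices has at least `n / (k - 1)` hyperedges. -/
theorem HypergraphIsConnected.le_card_mul {n k : ℕ} {E : Finset (Hyperedge n k)} (hk : 2 ≤ k)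
    (hnk : n ≠ k) (h : HypergraphIsConnected 2 E) : n ≤ E.card * (k - 1) := by
  classical
  obtain ⟨v, X, hX, Y, hY, hXY, hvX, hvY⟩ := h.exists_mem_two hnk
  have hn : 2 < n := by simpa using h.2.1
  have h1 := card_le_sum_of_preconnected_induce hn.le v (h.2.2 {v} (by simp))
  -- Each hyperedge contributes exactly k - 1 once its incidence with `v` is added back.
  have h2 : ∑ Z ∈ E, ((Z.1.erase v).card - 1) + ∑ Z ∈ E, (if v ∈ Z.1 then 1 else 0) =
      E.card * (k - 1) := by
    rw [← Finset.sum_add_distrib, ← smul_eq_mul, ← Finset.sum_const]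
    refine Finset.sum_congr rfl fun Z _ => ?_
    have hZ := Z.2
    split_ifs with hv
    · rw [Finset.card_erase_of_mem hv]; omega
    · rw [Finset.erase_eq_of_notMem hv]; omega
  have h3 : ∑ Z ∈ ({X, Y} : Finset (Hyperedge n k)), (if v ∈ Z.1 then 1 else 0) ≤
      ∑ Z ∈ E, (if v ∈ Z.1 then 1 else 0) :=
    Finset.sum_le_sum_of_subset (by simp [Finset.insert_subset_iff, hX, hY])
  rw [Finset.sum_pair hXY, if_pos hvX, if_pos hvY] at h3
  omega

/-! ### Full skeleta and homology: cones over cycles -/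

/-- A complex contains the full `(D - 1)`-skeleton of the simplex on its vertices. -/
def HasFullSkeleton {ι : Type*} (K : PreAbstractSimplicialComplex ι) (D : ℕ) : Prop :=
  ∀ s : Finset ι, s.Nonempty → s.card ≤ D → s ∈ K

section Cone

variable {ι : Type*} {q : ℕ}

/-- The function on tuples that strips a leading vertex `a` and vanishes on the other tuples. -/
def stripHead [DecidableEq ι] (a : ι) (c : (Fin q → ι) → ℤ) (t : Fin (q + 1) → ι) : ℤ :=
  if t 0 = a then c (Fin.tail t) else 0

/-- The cone with apex `a` over an alternating function on tuples. -/
def coneFun [DecidableEq ι] (a : ι) (c : (Fin q → ι) → ℤ) (t : Fin (q + 1) → ι) : ℤ :=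
  ∑ l, (Equiv.Perm.sign (Equiv.swap 0 l) : ℤ) * stripHead a c (t ∘ Equiv.swap 0 l)

theorem stripHead_comp_perm [DecidableEq ι] (a : ι) {c : (Fin q → ι) → ℤ}
    (hc : ∀ (σ : Equiv.Perm (Fin q)) (t : Fin q → ι), c (t ∘ σ) = (Equiv.Perm.sign σ : ℤ) * c t)
    (ρ : Equiv.Perm (Fin (q + 1))) (hρ : ρ 0 = 0) (t : Fin (q + 1) → ι) :
    stripHead a c (t ∘ ρ) = (Equiv.Perm.sign ρ : ℤ) * stripHead a c t := by
  obtain ⟨⟨p, σ⟩, rfl⟩ := Equiv.Perm.decomposeFin.symm.surjective ρ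
  rw [Equiv.Perm.decomposeFin_symm_apply_zero] at hρ
  subst hρ
  have ht : t ∘ Equiv.Perm.decomposeFin.symm (0, σ) = Fin.cons (t 0) (Fin.tail t ∘ σ) := by
    rw [cons_comp_perm, Fin.cons_self_tail]
  rw [ht, Equiv.Perm.decomposeFin.symm_sign]
  simp [stripHead, hc]

/-- The swaps of 0 and l represent the cosets of the stabilizer of 0, under which `stripHead` is
already alternating; a permutation only permutes these cosets. -/
theorem coneFun_comp_perm [DecidableEq ι] (a : ι) {c : (Fin q → ι) → ℤ}
    (hc : ∀ (σ : Equiv.Perm (Fin q)) (t : Fin q → ι), c (t ∘ σ) = (Equiv.Perm.sign σ : ℤ) * c t)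
    (σ : Equiv.Perm (Fin (q + 1))) (t : Fin (q + 1) → ι) :
    coneFun a c (t ∘ σ) = (Equiv.Perm.sign σ : ℤ) * coneFun a c t := by
  rw [coneFun, coneFun, Finset.mul_sum]
  refine Fintype.sum_equiv σ _ _ fun l => ?_
  have h : (t ∘ σ) ∘ Equiv.swap 0 l =
      (t ∘ Equiv.swap 0 (σ l)) ∘ (Equiv.swap 0 (σ l) * σ * Equiv.swap 0 l) := by
    funext x
    simp
  rw [h, stripHead_comp_perm a hc _ (by simp)]
  have h2 : ((Equiv.Perm.sign (Equiv.swap 0 l) : ℤˣ) : ℤ) * (Equiv.Perm.sign (Equiv.swap 0 l) : ℤˣ)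
      = 1 := by
    rw [← Units.val_mul, Int.units_mul_self, Units.val_one]
  simp only [Equiv.Perm.sign_mul, Units.val_mul]
  linear_combination ((Equiv.Perm.sign (Equiv.swap 0 (σ l)) : ℤˣ) : ℤ) *
    (Equiv.Perm.sign σ : ℤˣ) * stripHead a c (t ∘ Equiv.swap 0 (σ l)) * h2

theorem eq_zero_of_alternating_of_not_injective {c : (Fin q → ι) → ℤ}
    (hc : ∀ (σ : Equiv.Perm (Fin q)) (t : Fin q → ι), c (t ∘ σ) = (Equiv.Perm.sign σ : ℤ) * c t)
    {t : Fin q → ι} (ht : ¬ Function.Injective t) : c t = 0 := by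
  simp only [Function.Injective, not_forall] at ht
  obtain ⟨x, y, hxy, hne⟩ := ht
  have h := hc (Equiv.swap x y) t
  have ht : t ∘ Equiv.swap x y = t := by
    funext z
    simp only [Function.comp_apply, Equiv.swap_apply_def]
    split_ifs with h1 h2
    · rw [h1, hxy]
    · rw [h2, hxy]
    · rfl
  rw [ht, Equiv.Perm.sign_swap hne] at h
  simp at h
  omega

theorem sum_update_eq_zero [Fintype ι] {c : (Fin (q + 1) → ι) → ℤ}
    (hc : ∀ (σ : Equiv.Perm (Fin (q + 1))) (t : Fin (q + 1) → ι),
      c (t ∘ σ) = (Equiv.Perm.sign σ : ℤ) * c t)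
    (hcyc : ∀ t : Fin q → ι, ∑ v, c (Fin.cons v t) = 0) (t : Fin (q + 1) → ι) (m : Fin (q + 1)) :
    ∑ v, c (Function.update t m v) = 0 := by
  have h : ∀ v, c (Function.update t m v) = (Equiv.Perm.sign (Equiv.swap 0 m) : ℤ) *
      c (Fin.cons v (Fin.tail (t ∘ Equiv.swap 0 m))) := by
    intro v
    rw [← hc]
    congr 1
    funext x
    rcases eq_or_ne x m with rfl | hx
    · simp
    · rw [Function.update_of_ne hx]
      rcases eq_or_ne x 0 with rfl | h0
      · obtain ⟨m', rfl⟩ := Fin.exists_succ_eq.2 hx.symm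
        simp [Fin.tail]
      · obtain ⟨x', rfl⟩ := Fin.exists_succ_eq.2 h0
        simp [Equiv.swap_apply_of_ne_of_ne h0 hx, Fin.tail]
  simp_rw [h]
  rw [← Finset.mul_sum, hcyc, mul_zero]

/-- This is ∂(a * c) = c - a * ∂c for a cycle c. The swap with l = 0 yields c; any other swap
replaces an entry `a` of `t` by the summation variable, and the cycle condition kills the sum. -/
theorem sum_coneFun_cons [Fintype ι] [DecidableEq ι] (a : ι) {c : (Fin (q + 1) → ι) → ℤ}
    (hc : ∀ (σ : Equiv.Perm (Fin (q + 1))) (t : Fin (q + 1) → ι),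
      c (t ∘ σ) = (Equiv.Perm.sign σ : ℤ) * c t)
    (hcyc : ∀ t : Fin q → ι, ∑ v, c (Fin.cons v t) = 0) (t : Fin (q + 1) → ι) :
    ∑ v, coneFun a c (Fin.cons v t) = c t := by
  simp only [coneFun]
  rw [Finset.sum_comm, Fin.sum_univ_succ]
  have h0 : ∑ v, ((Equiv.Perm.sign (Equiv.swap (0 : Fin (q + 2)) 0) : ℤˣ) : ℤ) *
      stripHead a c ((Fin.cons v t : Fin (q + 2) → ι) ∘ Equiv.swap 0 0) = c t := by
    simp [stripHead]
  rw [h0, add_eq_left]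
  refine Finset.sum_eq_zero fun m _ => ?_
  rw [← Finset.mul_sum]
  have h1 : ∀ v, stripHead a c ((Fin.cons v t : Fin (q + 2) → ι) ∘ Equiv.swap 0 m.succ) =
      if t m = a then c (Function.update t m v) else 0 := by
    intro v
    have h2 : Fin.tail ((Fin.cons v t : Fin (q + 2) → ι) ∘ Equiv.swap 0 m.succ) =
        Function.update t m v := by
      funext x
      rcases eq_or_ne x m with rfl | hx
      · simp [Fin.tail]
      · rw [Function.update_of_ne hx]
        simp [Fin.tail, Equiv.swap_apply_of_ne_of_ne (Fin.succ_ne_zero x)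
          (fun h => hx (Fin.succ_injective _ h))]
    rw [stripHead, h2]
    simp
  simp_rw [h1]
  split_ifs
  · rw [sum_update_eq_zero hc hcyc, mul_zero]
  · simp

end Cone

/-- The reduced homology of a complex vanishes below the dimension of a full skeleton. -/
theorem HasFullSkeleton.subsingleton_reducedHomology {ι : Type*} [Fintype ι] [DecidableEq ι]
    {K : PreAbstractSimplicialComplex ι} {D : ℕ} (hK : HasFullSkeleton K D) {i : ℕ}
    (hi : i + 2 ≤ D) : Subsingleton (ReducedHomology K i) := by
  rw [Submodule.Quotient.subsingleton_iff, Submodule.submoduleOf_eq_top]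
  intro c hc
  rw [LinearMap.mem_ker] at hc
  have hcyc : ∀ t : Fin i → ι, ∑ v, c.1 (Fin.cons v t) = 0 := fun t => congrFun (congrArg Subtype.val hc) t
  rcases isEmpty_or_nonempty ι with hι | ⟨⟨a⟩⟩
  · have : c = 0 := by
      ext t
      exact hι.elim (t 0)
    rw [this]
    exact Submodule.zero_mem _
  · refine ⟨⟨coneFun a c.1, fun t ht => ?_, coneFun_comp_perm a c.2.2⟩, ?_⟩
    -- Alternation disposes of tuples with a repeated vertex; an injective tuple has i + 2 ≤ D
    -- vertices and so lists a simplex.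
    · refine eq_zero_of_alternating_of_not_injective (coneFun_comp_perm a c.2.2) fun hinj => ht ?_
      refine ⟨hinj, Or.inr (hK _ (by simp) ?_)⟩
      rw [Finset.card_image_of_injective _ hinj, Finset.card_univ, Fintype.card_fin]
      exact hi
    · ext t
      exact sum_coneFun_cons a c.2.2 hcyc t

/-! ### General position by small translations -/

section GeneralPosition

variable {ι : Type*} [Fintype ι] {E : Type*} [NormedAddCommGroup E] [NormedSpace ℝ E]
  [FiniteDimensional ℝ E]

/-- The translations that make the coordinates in `T` of a smooth map coincide somewhere form a set
of small dimension. -/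
theorem dimH_setOf_translate_tie_lt {G : E → ι → ℝ} (hG : ContDiff ℝ 1 G) {D : ℕ}
    (hD : Module.finrank ℝ E < D) {T : Finset ι} (hT : T.card = D + 1) :
    dimH {w : ι → ℝ | ∃ x s, ∀ v ∈ T, G x v + w v = s} < Module.finrank ℝ (ι → ℝ) := by
  classical
  -- A bad translation is determined by the point, the common value and its coordinates outside `T`:
  -- dim E + 1 + (|ι| - D - 1) < |ι| parameters.
  let Φ : E × ℝ × ({v // v ∉ T} → ℝ) → ι → ℝ := fun p v =>
    if h : v ∈ T then p.2.1 - G p.1 v else p.2.2 ⟨v, h⟩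
  have hΦ : ContDiff ℝ 1 Φ := by
    rw [contDiff_pi]
    intro v
    by_cases h : v ∈ T
    · simp only [Φ, h, dite_true]
      have := contDiff_pi.1 hG v
      fun_prop
    · simp only [Φ, h, dite_false]
      fun_prop
  have hsub : {w : ι → ℝ | ∃ x s, ∀ v ∈ T, G x v + w v = s} ⊆ Set.range Φ := by
    rintro w ⟨x, s, hw⟩
    refine ⟨(x, s, fun v => w v), ?_⟩
    funext v
    by_cases h : v ∈ T
    · simp only [Φ, h, dite_true, ← hw v h]
      ring
    · simp only [Φ, h, dite_false]
  refine ((dimH_mono hsub).trans hΦ.dimH_range_le).trans_lt (Nat.cast_lt.2 ?_)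
  have h1 : Fintype.card {v // v ∉ T} = Fintype.card ι - T.card := by
    rw [Fintype.card_subtype_compl, Fintype.card_coe]
  have h2 := Finset.card_le_univ T
  simp only [Module.finrank_prod, Module.finrank_self, Module.finrank_fintype_fun_eq_card, h1]
  omega

/-- A continuous map can be approximated by one whose coordinates are in general position: no `D + 1`
of them coincide, where `D` exceeds the dimension of the source. -/
theorem exists_continuous_approx_no_tie [Nonempty ι] {F : E → ι → ℝ} (hF : Continuous F) {ε : ℝ} (hε : 0 < ε)
    {D : ℕ} (hD : Module.finrank ℝ E < D) :
    ∃ G : E → ι → ℝ, Continuous G ∧ (∀ x v, |G x v - F x v| < ε) ∧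
      ∀ T : Finset ι, T.card = D + 1 → ∀ x s, ¬ ∀ v ∈ T, G x v = s := by
  obtain ⟨G, hG, hGF, -⟩ := hF.exists_contDiff_approx 1 (ε := fun _ => ε / 2) continuous_const
    fun _ => half_pos hε
  have hbad : dimH (⋃ T : {T : Finset ι // T.card = D + 1},
      {w : ι → ℝ | ∃ x s, ∀ v ∈ T.1, G x v + w v = s}) < Module.finrank ℝ (ι → ℝ) := by
    rw [dimH_iUnion]
    rcases isEmpty_or_nonempty {T : Finset ι // T.card = D + 1} with h | h
    · rw [iSup_of_empty, Module.finrank_fintype_fun_eq_card]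
      exact Nat.cast_pos.2 Fintype.card_pos
    · obtain ⟨T, hT⟩ := exists_eq_ciSup_of_finite (f := fun T : {T : Finset ι // T.card = D + 1} =>
        dimH {w : ι → ℝ | ∃ x s, ∀ v ∈ T.1, G x v + w v = s})
      rw [← hT]
      exact dimH_setOf_translate_tie_lt hG hD T.2
  obtain ⟨w, hwb, hw⟩ := (dense_compl_of_dimH_lt_finrank hbad).exists_dist_lt 0 (half_pos hε)
  refine ⟨fun x => G x + w, by have := hG.continuous; fun_prop, fun x v => ?_, fun T hT x s h => ?_⟩
  · have h1 := (dist_le_pi_dist (G x) (F x) v).trans_lt (hGF x)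
    have h2 := (dist_le_pi_dist 0 w v).trans_lt hw
    rw [Real.dist_eq] at h1 h2
    rw [abs_lt] at h1 h2 ⊢
    simp only [Pi.add_apply, Pi.zero_apply] at h2 ⊢
    constructor <;> linarith [h1.1, h1.2, h2.1, h2.2]
  · exact hwb (Set.mem_iUnion.2 ⟨⟨T, hT⟩, x, s, h⟩)

end GeneralPosition

/-! ### Pushing points into the (D - 1)-skeleton -/

section Truncation

variable {ι : Type*} [Fintype ι] [DecidableEq ι]

/-- A map that retains, of the coordinates above `ε`, only those not minimal in a `(D + 1)`-set. -/
def truncateCoords (D : ℕ) (ε : ℝ) (y : ι → ℝ) (v : ι) : ℝ :=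
  max (y v - ε) 0 * ∏ T ∈ Finset.univ.powersetCard (D + 1) with v ∈ T, ∑ u ∈ T, max (y v - y u) 0

theorem continuous_truncateCoords (D : ℕ) (ε : ℝ) :
    Continuous (truncateCoords D ε : (ι → ℝ) → ι → ℝ) := by
  unfold truncateCoords
  fun_prop

theorem truncateCoords_nonneg (D : ℕ) (ε : ℝ) (y : ι → ℝ) (v : ι) : 0 ≤ truncateCoords D ε y v :=
  mul_nonneg (le_max_right _ _) (Finset.prod_nonneg fun _ _ => Finset.sum_nonneg fun _ _ =>
    le_max_right _ _)

theorem lt_of_truncateCoords_ne_zero {D : ℕ} {ε : ℝ} {y : ι → ℝ} {v : ι}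
    (h : truncateCoords D ε y v ≠ 0) : ε < y v := by
  by_contra! hle
  exact h (by rw [truncateCoords, max_eq_right (by linarith), zero_mul])

/-- Among D + 1 surviving coordinates, a smallest one would have a vanishing factor. -/
theorem card_support_truncateCoords_le (D : ℕ) (ε : ℝ) (y : ι → ℝ) :
    (Finset.univ.filter fun v => truncateCoords D ε y v ≠ 0).card ≤ D := by
  by_contra! hlt
  obtain ⟨T, hTs, hT⟩ := Finset.exists_subset_card_eq (Nat.succ_le_of_lt hlt)
  obtain ⟨v, hv, hmin⟩ := T.exists_min_image y (Finset.card_pos.1 (by omega))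
  refine (Finset.mem_filter.1 (hTs hv)).2 ?_
  rw [truncateCoords, mul_eq_zero]
  refine Or.inr (Finset.prod_eq_zero (i := T) (by simp [hT, hv]) ?_)
  exact Finset.sum_eq_zero fun u hu => max_eq_right (by linarith [hmin u hu])

/-- A largest coordinate survives: without ties, every (D + 1)-set containing it has a strictly
smaller member. -/
theorem exists_truncateCoords_pos {D : ℕ} {ε : ℝ} {y : ι → ℝ}
    (hy : ∀ T : Finset ι, T.card = D + 1 → ∀ s, ¬ ∀ v ∈ T, y v = s) (h : ∃ v, ε < y v) :
    ∃ v, 0 < truncateCoords D ε y v := by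
  obtain ⟨w, hw⟩ := h
  obtain ⟨v, -, hmax⟩ := Finset.univ.exists_max_image y ⟨w, Finset.mem_univ w⟩
  refine ⟨v, mul_pos (lt_max_of_lt_left (by linarith [hmax w (Finset.mem_univ w)])) ?_⟩
  refine Finset.prod_pos fun T hT => ?_
  have hT := (Finset.mem_powersetCard.1 (Finset.mem_filter.1 hT).1).2
  have hne := hy T hT (y v)
  push Not at hne
  obtain ⟨u, hu, huv⟩ := hne
  refine Finset.sum_pos' (fun _ _ => le_max_right _ _) ⟨u, hu, lt_max_of_lt_left ?_⟩
  have := lt_of_le_of_ne (hmax u (Finset.mem_univ u)) huv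
  linarith

end Truncation

/-! ### Extending maps from spheres to balls -/

section Extension

variable {ι : Type*} [Fintype ι] {E : Type*} [NormedAddCommGroup E] [NormedSpace ℝ E]

/-- A map from the unit sphere to a simplex extends to a map to the nonnegative orthant that stays
away from the origin and is constant along the rays outside a smaller ball. -/
theorem exists_radial_extension [Nonempty ι] (K : PreAbstractSimplicialComplex ι)
    (f : C(Metric.sphere (0 : E) 1, realization K)) :
    ∃ F : E → ι → ℝ, Continuous F ∧ (∀ x v, 0 ≤ F x v) ∧ (∀ x, 1 ≤ ∑ v, F x v) ∧
      (∀ x : Metric.sphere (0 : E) 1, F x.1 = (f x).1) ∧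
      ∀ x : E, 1 / 2 ≤ ‖x‖ → ∃ z, F x = (f z).1 := by
  obtain ⟨φ, hφ⟩ := ContinuousMap.exists_restrict_eq (Metric.isClosed_sphere (x := (0 : E)) (ε := 1))
    (⟨fun x => (f x).1, by fun_prop⟩ : C(Metric.sphere (0 : E) 1, ι → ℝ))
  -- The deficit of the coordinate sum from 1 is added to every coordinate; on the sphere it is
  -- zero.
  let ψ : E → ι → ℝ := fun x v => max (φ x v) 0 + max (1 - ∑ u, max (φ x u) 0) 0
  have hψ : Continuous ψ := by
    unfold ψ
    fun_prop
  have hψf : ∀ x : Metric.sphere (0 : E) 1, ψ x.1 = (f x).1 := by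
    intro x
    have h1 : φ x.1 = (f x).1 := DFunLike.congr_fun hφ x
    obtain ⟨h2, h3, -⟩ := (f x).2
    funext v
    simp only [ψ, h1, max_eq_left (h2 _), h3]
    simp
  have hρ : Continuous fun x : E => ψ ((max ‖x‖ (1 / 2))⁻¹ • x) := by
    refine hψ.comp (Continuous.smul (Continuous.inv₀ (by fun_prop) fun x => ?_) continuous_id)
    exact (lt_max_of_lt_right (by norm_num)).ne'
  refine ⟨_, hρ, fun x v => add_nonneg (le_max_right _ _) (le_max_right _ _), fun x => ?_,
    fun x => ?_, fun x hx => ?_⟩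
  · simp only [ψ, Finset.sum_add_distrib, Finset.sum_const, Finset.card_univ, nsmul_eq_mul]
    set y := (max ‖x‖ (1 / 2))⁻¹ • x
    have hc : (1 : ℝ) ≤ Fintype.card ι := by exact_mod_cast Fintype.card_pos
    nlinarith [le_max_left (1 - ∑ u, max (φ y u) 0) 0, le_max_right (1 - ∑ u, max (φ y u) 0) 0]
  · have : ‖x.1‖ = 1 := mem_sphere_zero_iff_norm.1 x.2
    rw [← hψf]
    norm_num [this]
  · have hmem : (max ‖x‖ (1 / 2))⁻¹ • x ∈ Metric.sphere (0 : E) 1 := by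
      rw [max_eq_left hx, mem_sphere_zero_iff_norm, norm_smul, norm_inv, norm_norm]
      exact inv_mul_cancel₀ (by linarith)
    exact ⟨⟨_, hmem⟩, hψf ⟨_, hmem⟩⟩

/-- Spheres of low dimension in a complex with full skeleton bound balls. -/
theorem HasFullSkeleton.exists_extension [FiniteDimensional ℝ E]
    {K : PreAbstractSimplicialComplex ι} {D : ℕ} (hK : HasFullSkeleton K D)
    (hD : Module.finrank ℝ E < D) [Nonempty ι]
    (f : C(Metric.sphere (0 : E) 1, realization K)) :
    ∃ g : C(Metric.closedBall (0 : E) 1, realization K), ∀ x : Metric.sphere (0 : E) 1,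
      g ⟨x.1, Metric.sphere_subset_closedBall x.2⟩ = f x := by
  classical
  obtain ⟨F, hF, hF0, hF1, hFf, hFr⟩ := exists_radial_extension K f
  have hN : (0 : ℝ) < Fintype.card ι := by exact_mod_cast Fintype.card_pos
  -- If all coordinates of `G` were at most ε, those of `F` would be below 2ε and sum to less than
  -- 2/3, not to at least 1.
  set ε : ℝ := 1 / (3 * Fintype.card ι) with hεdef
  have hε : 0 < ε := by positivity
  obtain ⟨G, hG, hGF, htie⟩ := exists_continuous_approx_no_tie hF hε hD
  have hlarge : ∀ x, ∃ v, ε < G x v := by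
    intro x
    by_contra! hall
    have h1 : ∑ v, F x v < ∑ _v : ι, 2 * ε := by
      refine Finset.sum_lt_sum_of_nonempty Finset.univ_nonempty fun v _ => ?_
      have := (abs_lt.1 (hGF x v)).1
      linarith [hall v]
    have h2 : ∑ _v : ι, 2 * ε = 2 / 3 := by
      rw [Finset.sum_const, Finset.card_univ, nsmul_eq_mul, hεdef]
      field_simp
    linarith [hF1 x]
  -- The weight is 0 on the ball of radius 1/2 and 1 on the unit sphere, so `R` passes from the
  -- truncated map to `F`.
  set μ : E → ℝ := fun x => max (2 * ‖x‖ - 1) 0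
  set Y : E → ι → ℝ := fun x => truncateCoords D ε (G x) with hY
  set R : E → ι → ℝ := fun x v => μ x * F x v + max (1 - μ x) 0 * Y x v with hR
  have hYcont : Continuous Y := (continuous_truncateCoords D ε).comp hG
  have hRcont : Continuous R := by
    unfold R μ
    fun_prop
  have hμ0 : ∀ x, 0 ≤ μ x := fun x => le_max_right _ _
  have hR0 : ∀ x v, 0 ≤ R x v := fun x v => add_nonneg (mul_nonneg (hμ0 x) (hF0 x v))
    (mul_nonneg (le_max_right _ _) (truncateCoords_nonneg _ _ _ _))
  have hRpos : ∀ x, 0 < ∑ v, R x v := by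
    intro x
    have hY0 : 0 < ∑ v, Y x v := by
      obtain ⟨v, hv⟩ := exists_truncateCoords_pos (fun T hT => htie T hT x) (hlarge x)
      exact Finset.sum_pos' (fun _ _ => truncateCoords_nonneg _ _ _ _) ⟨v, Finset.mem_univ v, hv⟩
    simp only [hR, Finset.sum_add_distrib, ← Finset.mul_sum]
    rcases (hμ0 x).eq_or_lt with h | h
    · rw [← h]
      simpa using hY0
    · exact add_pos_of_pos_of_nonneg (mul_pos h (by linarith [hF1 x]))
        (mul_nonneg (le_max_right _ _) hY0.le)
  have hRsupp : ∀ x, ∃ s ∈ K, ∀ v, v ∉ s → R x v = 0 := by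
    intro x
    rcases le_total ‖x‖ (1 / 2) with hx | hx
    · have hRY : R x = Y x := by
        funext v
        simp [hR, μ, max_eq_right (show 2 * ‖x‖ - 1 ≤ 0 by linarith)]
      refine ⟨Finset.univ.filter fun v => Y x v ≠ 0, hK _ ?_
        (card_support_truncateCoords_le D ε (G x)), fun v hv => ?_⟩
      · obtain ⟨v, hv⟩ := exists_truncateCoords_pos (fun T hT => htie T hT x) (hlarge x)
        exact ⟨v, by simpa using hv.ne'⟩
      · rw [hRY]
        simpa using hv
    -- In the outer shell a zero coordinate of `F` is below ε in `G`, so truncation removes it: the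
    -- support of `R` stays in a simplex carrying a value of `f`.
    · obtain ⟨z, hz⟩ := hFr x hx
      obtain ⟨-, -, s, hs, hzs⟩ := (f z).2
      refine ⟨s, hs, fun v hv => ?_⟩
      have hFv : F x v = 0 := by rw [hz, hzs v hv]
      have hYv : Y x v = 0 := by
        by_contra hne
        have h1 := lt_of_truncateCoords_ne_zero hne
        have h2 := (abs_lt.1 (hGF x v)).2
        linarith
      simp [hR, hFv, hYv]
  refine ⟨⟨fun x => ⟨fun v => R x.1 v / ∑ u, R x.1 u, fun v => div_nonneg (hR0 _ _) (hRpos _).le,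
    by rw [← Finset.sum_div, div_self (hRpos _).ne'], ?_⟩, ?_⟩, ?_⟩
  · obtain ⟨s, hs, h⟩ := hRsupp x.1
    exact ⟨s, hs, fun v hv => by simp only [h v hv, zero_div]⟩
  · refine Continuous.subtype_mk (continuous_pi fun v => Continuous.div ?_ ?_
      fun x => (hRpos _).ne') _ <;> fun_prop
  · intro x
    have hx : ‖x.1‖ = 1 := mem_sphere_zero_iff_norm.1 x.2
    have hRf : R x.1 = (f x).1 := by
      funext v
      simp only [hR, μ, hx, ← hFf]
      norm_num
    refine Subtype.ext ?_
    funext v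
    change R x.1 v / ∑ u, R x.1 u = _
    rw [hRf, (f x).2.2.1, div_one]

end Extension

/-- A complex with full `(D - 1)`-skeleton is `(D - 2)`-connected. -/
theorem HasFullSkeleton.topologicallyConnected {ι : Type*} [Fintype ι]
    {K : PreAbstractSimplicialComplex ι} {D : ℕ} (hK : HasFullSkeleton K D) {r : ℤ}
    (hr : r + 2 ≤ D) (hne : -1 ≤ r → Nonempty ι) : TopologicallyConnected r (realization K) := by
  classical
  refine ⟨fun h => ?_, fun j hj f => ?_⟩
  · obtain ⟨a⟩ := hne h
    refine ⟨⟨Pi.single a 1, fun v => ?_, by simp, {a}, hK _ (by simp) ?_, fun v hv => ?_⟩⟩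
    · by_cases hv : v = a <;> simp [hv]
    · rw [Finset.card_singleton]
      omega
    · exact Pi.single_eq_of_ne (by simpa using hv) _
  · have : Nonempty ι := hne (by omega)
    exact hK.exists_extension (by rw [finrank_euclideanSpace_fin]; omega) f

/-! ### The complex of not 2-connected k-graphs -/

theorem hasFullSkeleton_notConnectedComplex {n k : ℕ} (hk : 2 ≤ k) (hnk : n ≠ k) :
    HasFullSkeleton (notConnectedComplex 2 n k) (⌈(n : ℚ) / ((k : ℚ) - 1)⌉ - 1).toNat := by
  refine fun s hs hcard => ⟨hs, fun hcon => ?_⟩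
  have h1 := hcon.le_card_mul hk hnk
  have h2 := hs.card_pos
  have h3 : (s.card : ℤ) < ⌈(n : ℚ) / ((k : ℚ) - 1)⌉ := by omega
  have hk' : (2 : ℚ) ≤ k := by exact_mod_cast hk
  rw [Int.lt_ceil, Int.cast_natCast, lt_div_iff₀ (by linarith)] at h3
  have h4 : (n : ℚ) ≤ s.card * ((k : ℚ) - 1) := by
    rw [← Nat.cast_one, ← Nat.cast_sub (by omega)]
    exact_mod_cast h1
  linarith

theorem corollary5p15 (n k : ℕ) (hk : 2 ≤ k) :
    (n ≠ k → TopologicallyConnected (⌈(n : ℚ) / ((k : ℚ) - 1)⌉ - 3)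
        (realization (notConnectedComplex 2 n k))) ∧
      ∀ i : ℕ, (i : ℤ) ≤ ⌈(n : ℚ) / ((k : ℚ) - 1)⌉ - 3 →
        Subsingleton (ReducedHomology (notConnectedComplex 2 n k) i) := by
  have hk' : (2 : ℚ) ≤ k := by exact_mod_cast hk
  refine ⟨fun hnk => ?_, fun i hi => ?_⟩
  · refine (hasFullSkeleton_notConnectedComplex hk hnk).topologicallyConnected (by omega) fun h => ?_
    -- Nonemptiness is demanded only when n > k - 1, and then a hyperedge exists.
    have h1 : (1 : ℤ) < ⌈(n : ℚ) / ((k : ℚ) - 1)⌉ := by omega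
    rw [Int.lt_ceil, lt_div_iff₀ (by linarith)] at h1
    have h2 : k < n + 1 := by
      have : (k : ℚ) < n + 1 := by push_cast at h1; linarith
      exact_mod_cast this
    obtain ⟨X, -, hX⟩ := Finset.exists_subset_card_eq
      (show k ≤ (Finset.univ : Finset (Fin n)).card by rw [Finset.card_univ, Fintype.card_fin]; omega)
    exact ⟨⟨X, hX⟩⟩
  · rcases eq_or_ne n k with rfl | hnk
    -- For n = k the range of `i` is empty, as n/(n - 1) ≤ 2.
    · have h1 : (2 : ℤ) < ⌈(n : ℚ) / ((n : ℚ) - 1)⌉ := by omega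
      rw [Int.lt_ceil, lt_div_iff₀ (by linarith)] at h1
      push_cast at h1
      linarith
    · exact (hasFullSkeleton_notConnectedComplex hk hnk).subsingleton_reducedHomology (by omega)
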